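/- **Conventions.** Let $\Gamma$ be a group with neutral element $1$. Elements $a,b\in\Gamma$ are *equivalent* if $a=b$ or $a=b^{-1}$. For $g,h\in\Gamma$ put $[g,h]_1:=gh^{-1}g^{-1}h$ and $[g,h]_{m+1}:=[g,[g,h]_m]_1$. For an integer $n\ge 1$, we say that $\Gamma$ is *nilpotent of class $\le n$* if $[g,h]_n=1$ for all inequivalent $g,h\in\Gamma$. (Every group of nilpotency class at most $n$ in the usual sense has this property, and only this property is assumed here.) A *generating set* $S\subseteq\Gamma\setminus\{1\}$ is closed under inverses, and $\mathrm{Cay}(\Gamma,S)$ is the simple graph on $\Gamma$ with edges $\{g,gs\}$ for $g\in\Gamma$, $s\in S$. Let $G$ be a graph and $r$ a positive integer. For a vertex $v$, the *ball* $B_r(v)$ is the subgraph of $G$ formed by all vertices and edges that lie on closed walks of length at most $r$ passing through $v$. The vertex $v$ is an *$r$-local cutvertex* of $G$ if $B_r(v)-v$ is disconnected. For two distinct vertices $v_0,v_1$, the *connectivity graph* $C_r(v_0,v_1)$ has as vertices all vertices outside $\{v_0,v_1\}$ that are adjacent to $v_0$ or $v_1$; two of these are adjacent if they lie in the same component of $B_r(v_i)-v_0-v_1$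 for some $i\in\{0,1\}$. The set $\{v_0,v_1\}$ is an *$r$-local $2$-separator* of $G$ if $C_r(v_0,v_1)$ is disconnected and $v_0,v_1$ have distance at most $r/2$ in $G$. **Theorem.** Let $n\ge 1$ be an integer, let $\Gamma$ be a group that is nilpotent of class $\le n$, let $S\subseteq\Gamma\setminus\{1\}$ be a generating set of $\Gamma$, and let $G:=\mathrm{Cay}(\Gamma,S)$. Let $r\ge 2^{n+2}$ be an integer. Let $h\in S$ be such that $\{1,h\}$ is an $r$-local $2$-separator of $G$, and suppose that $G$ has no $r$-local cutvertex. If $h$ is not an involution, then $S\subseteq\{h,h^{-1},h^{2},h^{-2}\}$; in particular, $\Gamma$ is cyclic. -/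

import Mathlib

section LocalSeparators

variable {V : Type*}

/-- The ball of diameter `r` around `v`: the subgraph of `G` whose vertices and edges are those that
lie on closed walks of length at most `r` passing through `v`. -/
def localBall (G : SimpleGraph V) (r : ℕ) (v : V) : G.Subgraph where
  verts := {x | ∃ (u : V) (w : G.Walk u u), w.length ≤ r ∧ v ∈ w.support ∧ x ∈ w.support}
  Adj a b := ∃ (u : V) (w : G.Walk u u), w.length ≤ r ∧ v ∈ w.support ∧ s(a, b) ∈ w.edges
  adj_sub := by
    rintro a b ⟨u, w, -, -, h⟩
    exact w.adj_of_mem_edges h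
  edge_vert := by
    rintro a b ⟨u, w, hr, hv, h⟩
    exact ⟨u, w, hr, hv, w.fst_mem_support_of_mem_edges h⟩
  symm := ⟨by
    rintro a b ⟨u, w, hr, hv, h⟩
    exact ⟨u, w, hr, hv, by rwa [Sym2.eq_swap]⟩⟩

/-- `v` is an `r`-local cutvertex of `G`: the punctured ball of diameter `r` around `v`
is disconnected. -/
def IsLocalCutvertex (G : SimpleGraph V) (r : ℕ) (v : V) : Prop :=
  ¬ ((localBall G r v).deleteVerts {v}).coe.Preconnected

/-- The neighbourhood `N(X)`: the vertices outside `X` that have a neighbour in `X`. -/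
def setNeighborhood (G : SimpleGraph V) (X : Set V) : Set V :=
  {a | a ∉ X ∧ ∃ x ∈ X, G.Adj x a}

/-- `a` and `b` are vertices of the subgraph `H` that lie in the same component of `H`. -/
def InSameComponent {G : SimpleGraph V} (H : G.Subgraph) (a b : V) : Prop :=
  ∃ (ha : a ∈ H.verts) (hb : b ∈ H.verts), H.coe.Reachable ⟨a, ha⟩ ⟨b, hb⟩

/-- The connectivity graph at `{v₀, v₁}` of locality `r`. -/
def connectivityGraph (G : SimpleGraph V) (r : ℕ) (v₀ v₁ : V) :
    SimpleGraph (setNeighborhood G {v₀, v₁}) :=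
  SimpleGraph.fromRel fun a b =>
    InSameComponent ((localBall G r v₀).deleteVerts {v₀, v₁}) a b ∨
    InSameComponent ((localBall G r v₁).deleteVerts {v₀, v₁}) a b

/-- `{v₀, v₁}` is an `r`-local 2-separator of `G`: the two vertices are distinct, at distance at most
`r / 2` in `G`, and their connectivity graph of locality `r` is disconnected. -/
def IsLocalTwoSeparator (G : SimpleGraph V) (r : ℕ) (v₀ v₁ : V) : Prop :=
  v₀ ≠ v₁ ∧ 2 * G.edist v₀ v₁ ≤ (r : ℕ∞) ∧ ¬ (connectivityGraph G r v₀ v₁).Preconnected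

end LocalSeparators

section Commutators

open scoped commutatorElement

variable {Γ : Type*} [Group Γ]

/-- The value in `Γ` of the iterated commutator word `[g, h]_n`, where
`[g, h]_1 = g h⁻¹ g⁻¹ h` and `[g, h]_{n+1} = [g, [g, h]_n]_1`; the value at `0` is chosen so that
the recursion starts one step earlier. -/
def iterCommutator (g h : Γ) : ℕ → Γ
  | 0 => h
  | n + 1 => g * (iterCommutator g h n)⁻¹ * g⁻¹ * iterCommutator g h n

/-- Two group elements are equivalent if they are equal or inverse to each other. -/
def EquivElem (a b : Γ) : Prop := a = b ∨ a = b⁻¹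

variable (Γ) in
/-- `Γ` is nilpotent of class at most `n` (for `n ≥ 1`) in the sense that `[g, h]_n = 1` for all
inequivalent `g` and `h`. Every group of nilpotency class at most `n` in Mathlib's sense has this
property: see `IteratedCommutatorsVanish.of_nilpotencyClass_le`. -/
def IteratedCommutatorsVanish (n : ℕ) : Prop :=
  ∀ g h : Γ, ¬ EquivElem g h → iterCommutator g h n = 1

theorem iterCommutator_mem_lowerCentralSeries (g h : Γ) (n : ℕ) :
    iterCommutator g h n ∈ (⊤ : Subgroup Γ).lowerCentralSeries n := by
  induction n with
  | zero => simp
  | succ n ih =>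
    have h1 : ⁅(iterCommutator g h n)⁻¹, g⁆ ∈ (⊤ : Subgroup Γ).lowerCentralSeries (n + 1) := by
      rw [Subgroup.lowerCentralSeries_succ]
      exact Subgroup.subset_closure ⟨_, inv_mem ih, g, Subgroup.mem_top g, rfl⟩
    have h2 := inv_mem h1
    rwa [commutatorElement_inv, commutatorElement_def, inv_inv] at h2

theorem IteratedCommutatorsVanish.of_nilpotencyClass_le [Group.IsNilpotent Γ] {n : ℕ}
    (hn : Group.nilpotencyClass Γ ≤ n) : IteratedCommutatorsVanish Γ n := by
  intro g h _
  have h1 := iterCommutator_mem_lowerCentralSeries g h n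
  rwa [Subgroup.lowerCentralSeries_eq_bot_iff_nilpotencyClass_le.mpr hn, Subgroup.mem_bot] at h1

end Commutators

/-! Suppose some g ∈ S is none of h^{±1}, h^{±2}. The claim is that the connectivity graph at {1, h}
is then connected, a contradiction. The crux is that its vertices g, hg, h⁻¹ and h² lie in one
component.

Put a = g h g⁻¹. If a is not equivalent to h, the relation [a, h]_n = 1 is a closed walk of length
2^{n+2} ≤ r whose steps alternate between h^{±1} and g, g⁻¹, g, g⁻¹, … Take a shortest closed walk
of this alternating kind. Being no longer than r, it lies in the ball around each of its vertices,
and minimality limits its repetitions and h-chords. If it contains g⁻¹ h^{±1} g, translate the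
middle edge to {1, h}. The rest of the walk joins g to hg. At the two ends of the edge it also joins
g to h⁻¹ and hg to h², unless the other vertex of a translated separator is on the walk; then it
joins h⁻¹ to h² instead (`GoodPair.linked_of_isMinAltWalk`). In every case h⁻¹ and h² are linked.

If the pattern is missing, the walk has at most five steps and g conjugates h^{±1} to a small power
of h; the same happens if a is equivalent to h. Then explicit squares or pentagons give the links.

Since h is not a local cutvertex, g is linked to h⁻¹ or hg to h² (`GoodPair.linked_or_linked`),
which completes all the links in `GoodPair.all_linked`. Applying this to every generator outside
h^{±1}, h^{±2}, and triangles for h^{±2}, connects the graph. -/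

open SimpleGraph

/-! ### Components of punctured balls and links in the connectivity graph -/

section LocalComponents

variable {V : Type*} {G : SimpleGraph V} {r : ℕ}

theorem InSameComponent.symm {H : G.Subgraph} {a b : V} (hab : InSameComponent H a b) :
    InSameComponent H b a := by
  obtain ⟨ha, hb, h⟩ := hab
  exact ⟨hb, ha, h.symm⟩

theorem InSameComponent.of_le {H : G.Subgraph} {a b : V} (p : G.Walk a b)
    (hp : p.toSubgraph ≤ H) : InSameComponent H a b := by
  have ha := p.start_mem_verts_toSubgraph
  have hb := p.end_mem_verts_toSubgraph
  have h := p.toSubgraph_connected.preconnected ⟨a, ha⟩ ⟨b, hb⟩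
  exact ⟨hp.1 ha, hp.1 hb, h.map (Subgraph.inclusion hp)⟩

/-- A subwalk of a closed walk of length at most `r` through `v` that avoids `X` stays in one
component of the ball around `v` minus `X`. -/
theorem inSameComponent_of_closed_walk {X : Set V} {v a b : V} (p : G.Walk a b) (q : G.Walk b a)
    (hv : v ∈ q.support) (hr : p.length + q.length ≤ r) (hX : ∀ x ∈ p.support, x ∉ X) :
    InSameComponent ((localBall G r v).deleteVerts X) a b := by
  have hverts : ∀ x ∈ p.support, x ∈ (localBall G r v).verts := fun x hx =>
    ⟨a, p.append q, by simpa using hr, by simp [hv], by simp [hx]⟩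
  refine InSameComponent.of_le p ⟨fun x hx => ?_, fun x y hxy => ?_⟩
  · rw [Walk.mem_verts_toSubgraph] at hx
    exact ⟨hverts x hx, hX x hx⟩
  · have hxs := (Walk.mem_verts_toSubgraph p).1 hxy.fst_mem
    have hys := (Walk.mem_verts_toSubgraph p).1 hxy.snd_mem
    rw [Walk.adj_toSubgraph_iff_mem_edges] at hxy
    exact Subgraph.deleteVerts_adj.2 ⟨hverts x hxs, hX x hxs, hverts y hys, hX y hys,
      a, p.append q, by simpa using hr, by simp [hv], by simp [hxy]⟩

theorem InSameComponent.map {X : Set V} {v a b : V} (φ : G ≃g G)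
    (hab : InSameComponent ((localBall G r v).deleteVerts X) a b) :
    InSameComponent ((localBall G r (φ v)).deleteVerts (φ '' X)) (φ a) (φ b) := by
  have hverts : ∀ x ∈ ((localBall G r v).deleteVerts X).verts,
      φ x ∈ ((localBall G r (φ v)).deleteVerts (φ '' X)).verts := by
    rintro x ⟨⟨u, w, hl, hv, hx⟩, hxX⟩
    refine ⟨⟨φ u, w.map φ.toHom, by simpa using hl, ?_, ?_⟩, ?_⟩
    · rw [Walk.support_map]; exact List.mem_map_of_mem (f := φ) hv
    · rw [Walk.support_map]; exact List.mem_map_of_mem (f := φ) hx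
    · rintro ⟨y, hy, hyx⟩
      exact hxX (φ.injective hyx ▸ hy)
  obtain ⟨ha, hb, h⟩ := hab
  refine ⟨hverts a ha, hverts b hb, h.map
    (⟨fun x => ⟨φ x.1, hverts x.1 x.2⟩, ?_⟩ :
      ((localBall G r v).deleteVerts X).coe →g
        ((localBall G r (φ v)).deleteVerts (φ '' X)).coe)⟩
  rintro ⟨x, hx⟩ ⟨y, hy⟩ hxy
  have hxy' : ((localBall G r v).deleteVerts X).Adj x y := hxy
  obtain ⟨-, -, -, -, u, w, hl, hv, he⟩ := Subgraph.deleteVerts_adj.1 hxy'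
  refine Subgraph.deleteVerts_adj.2 ⟨(hverts x hx).1, (hverts x hx).2, (hverts y hy).1,
    (hverts y hy).2, φ u, w.map φ.toHom, by simpa using hl, ?_, ?_⟩
  · rw [Walk.support_map]; exact List.mem_map_of_mem (f := φ) hv
  · rw [Walk.edges_map]; exact List.mem_map_of_mem (f := Sym2.map φ) he

/-- `a` and `b` are vertices of the connectivity graph at `{v₀, v₁}` in the same component. -/
def Linked (G : SimpleGraph V) (r : ℕ) (v₀ v₁ a b : V) : Prop :=
  ∃ (ha : a ∈ setNeighborhood G {v₀, v₁}) (hb : b ∈ setNeighborhood G {v₀, v₁}),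
    (connectivityGraph G r v₀ v₁).Reachable ⟨a, ha⟩ ⟨b, hb⟩

theorem Linked.symm {v₀ v₁ a b : V} (hab : Linked G r v₀ v₁ a b) : Linked G r v₀ v₁ b a := by
  obtain ⟨ha, hb, h⟩ := hab
  exact ⟨hb, ha, h.symm⟩

theorem Linked.trans {v₀ v₁ a b c : V} (hab : Linked G r v₀ v₁ a b) (hbc : Linked G r v₀ v₁ b c) :
    Linked G r v₀ v₁ a c := by
  obtain ⟨ha, hb, h⟩ := hab
  obtain ⟨_, hc, h'⟩ := hbc
  exact ⟨ha, hc, h.trans h'⟩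

theorem Linked.of_inSameComponent {v₀ v₁ a b : V} (ha : a ∈ setNeighborhood G {v₀, v₁})
    (hb : b ∈ setNeighborhood G {v₀, v₁})
    (h : InSameComponent ((localBall G r v₀).deleteVerts {v₀, v₁}) a b ∨
      InSameComponent ((localBall G r v₁).deleteVerts {v₀, v₁}) a b) :
    Linked G r v₀ v₁ a b := by
  refine ⟨ha, hb, ?_⟩
  by_cases hab : a = b
  · subst hab; exact Reachable.refl _
  · refine Adj.reachable ?_
    rw [connectivityGraph, fromRel_adj]
    exact ⟨fun h => hab (congrArg Subtype.val h), Or.inl h⟩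

/-- A walk through the punctured ball around `v₁` that ends at `v₂` either avoids `v₀`, or has an
initial part that leads to `v₀` and avoids `v₂`. -/
theorem inSameComponent_or_of_not_isLocalCutvertex {v₀ v₁ v₂ a : V}
    (hcut : ¬ IsLocalCutvertex G r v₁) (ha : a ∈ (localBall G r v₁).verts)
    (h₀ : v₀ ∈ (localBall G r v₁).verts) (h₂ : v₂ ∈ (localBall G r v₁).verts)
    (ha₁ : a ≠ v₁) (h₀₁ : v₀ ≠ v₁) (h₂₁ : v₂ ≠ v₁) (h₀₂ : v₀ ≠ v₂) :
    InSameComponent ((localBall G r v₁).deleteVerts {v₀, v₁}) a v₂ ∨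
      InSameComponent ((localBall G r v₁).deleteVerts {v₁, v₂}) a v₀ := by
  rw [IsLocalCutvertex, not_not] at hcut
  obtain ⟨w⟩ := hcut ⟨a, ha, ha₁⟩ ⟨v₂, h₂, h₂₁⟩
  suffices key : ∀ (x y : ((localBall G r v₁).deleteVerts {v₁}).verts)
      (w : ((localBall G r v₁).deleteVerts {v₁}).coe.Walk x y), y.1 = v₂ →
      InSameComponent ((localBall G r v₁).deleteVerts {v₀, v₁}) x.1 v₂ ∨
        InSameComponent ((localBall G r v₁).deleteVerts {v₁, v₂}) x.1 v₀ from key _ _ w rfl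
  have hv₂ : v₂ ∈ ((localBall G r v₁).deleteVerts {v₀, v₁}).verts :=
    ⟨h₂, by rintro (h | h) <;> [exact h₀₂ h.symm; exact h₂₁ h]⟩
  have hv₀ : v₀ ∈ ((localBall G r v₁).deleteVerts {v₁, v₂}).verts :=
    ⟨h₀, by rintro (h | h) <;> [exact h₀₁ h; exact h₀₂ h]⟩
  intro x y w hy
  induction w with
  | nil => exact Or.inl (by rw [hy]; exact ⟨hv₂, hv₂, Reachable.refl _⟩)
  | @cons x y z hxy w ih =>
    have hxy' : ((localBall G r v₁).deleteVerts {v₁}).Adj x.1 y.1 := hxy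
    obtain ⟨hx, hx₁, hy', hy₁, hadj⟩ := Subgraph.deleteVerts_adj.1 hxy'
    by_cases hx₂ : x.1 = v₂
    · exact Or.inl (by rw [hx₂]; exact ⟨hv₂, hv₂, Reachable.refl _⟩)
    by_cases hx₀ : x.1 = v₀
    · exact Or.inr (by rw [hx₀]; exact ⟨hv₀, hv₀, Reachable.refl _⟩)
    rcases ih hy with ⟨hyv, _, h⟩ | ⟨hyv, _, h⟩
    · have hxv : x.1 ∈ ((localBall G r v₁).deleteVerts {v₀, v₁}).verts :=
        ⟨hx, by rintro (h | h) <;> [exact hx₀ h; exact hx₁ h]⟩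
      refine Or.inl ⟨hxv, hv₂, Reachable.trans (Adj.reachable ?_) h⟩
      exact Subgraph.deleteVerts_adj.2 ⟨hxv.1, hxv.2, hyv.1, hyv.2, hadj⟩
    · have hxv : x.1 ∈ ((localBall G r v₁).deleteVerts {v₁, v₂}).verts :=
        ⟨hx, by rintro (h | h) <;> [exact hx₁ h; exact hx₂ h]⟩
      refine Or.inr ⟨hxv, hv₀, Reachable.trans (Adj.reachable ?_) h⟩
      exact Subgraph.deleteVerts_adj.2 ⟨hxv.1, hxv.2, hyv.1, hyv.2, hadj⟩

theorem mem_localBall_verts_of_adj {v a : V} (hr : 2 ≤ r) (h : G.Adj v a) :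
    a ∈ (localBall G r v).verts :=
  ⟨v, Walk.cons h (Walk.cons h.symm Walk.nil), by simpa using hr, by simp, by simp⟩

theorem exists_walk_of_seq (f : ℕ → V) {i j : ℕ} (hij : i ≤ j)
    (hf : ∀ k, i ≤ k → k < j → G.Adj (f k) (f (k + 1))) :
    ∃ p : G.Walk (f i) (f j), p.length = j - i ∧
      ∀ x ∈ p.support, ∃ k, i ≤ k ∧ k ≤ j ∧ f k = x := by
  induction j, hij using Nat.le_induction with
  | base => exact ⟨Walk.nil, by simp, fun x hx => ⟨i, le_rfl, le_rfl, (List.mem_singleton.1 hx).symm⟩⟩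
  | succ j hij ih =>
    obtain ⟨p, hl, hp⟩ := ih fun k h₁ h₂ => hf k h₁ (by omega)
    refine ⟨p.concat (hf j hij (by omega)), by rw [Walk.length_concat]; omega, fun x hx => ?_⟩
    rw [Walk.support_concat, List.mem_append, List.mem_singleton] at hx
    rcases hx with hx | rfl
    · obtain ⟨k, h₁, h₂, h₃⟩ := hp x hx
      exact ⟨k, h₁, by omega, h₃⟩
    · exact ⟨j + 1, by omega, le_rfl, rfl⟩

variable {s t i j : ℕ} {f : ℕ → V}

/-- On a closed walk of length at most `r`, a segment that avoids `X` and whose complement contains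
`v` stays in one component of the ball around `v` minus `X`. -/
theorem inSameComponent_of_segment (hf : ∀ k, s ≤ k → k < t → G.Adj (f k) (f (k + 1)))
    (hclosed : f s = f t) (hr : t - s ≤ r) (hsi : s ≤ i) (hij : i ≤ j) (hjt : j ≤ t) {X : Set V}
    (hX : ∀ k, i ≤ k → k ≤ j → f k ∉ X) {m : ℕ} (hsm : s ≤ m) (hmt : m ≤ t)
    (hm : m ≤ i ∨ j ≤ m) :
    InSameComponent ((localBall G r (f m)).deleteVerts X) (f i) (f j) := by
  obtain ⟨p, hpl, hp⟩ := exists_walk_of_seq f hij (G := G) fun k h₁ h₂ => hf k (by omega) (by omega)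
  have hpX : ∀ x ∈ p.support, x ∉ X := by
    intro x hx
    obtain ⟨k, h₁, h₂, rfl⟩ := hp x hx
    exact hX k h₁ h₂
  have hseg : ∀ a b, s ≤ a → a ≤ b → b ≤ t → ∃ q : G.Walk (f a) (f b), q.length = b - a := by
    intro a b h₁ h₂ h₃
    obtain ⟨q, hq, -⟩ := exists_walk_of_seq f h₂ (G := G) fun k h₄ h₅ => hf k (by omega) (by omega)
    exact ⟨q, hq⟩
  rcases hm with hm | hm
  · obtain ⟨q₁, h₁⟩ := hseg j t (by omega) hjt le_rfl
    obtain ⟨q₂, h₂⟩ := hseg s m le_rfl hsm hmt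
    obtain ⟨q₃, h₃⟩ := hseg m i hsm hm (by omega)
    refine inSameComponent_of_closed_walk p (((q₁.copy rfl hclosed.symm).append q₂).append q₃)
      (by simp) ?_ hpX
    simp only [Walk.length_append, Walk.length_copy]
    omega
  · obtain ⟨q₁, h₁⟩ := hseg j m (by omega) hm hmt
    obtain ⟨q₂, h₂⟩ := hseg m t hsm hmt le_rfl
    obtain ⟨q₃, h₃⟩ := hseg s i le_rfl hsi (by omega)
    refine inSameComponent_of_closed_walk p (q₁.append ((q₂.copy rfl hclosed.symm).append q₃))
      (by simp) ?_ hpX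
    simp only [Walk.length_append, Walk.length_copy]
    omega

/-- The complement of a segment of a closed walk of length at most `r`, if it avoids `X`, stays in
one component of the ball minus `X` around each vertex of the segment. -/
theorem inSameComponent_of_segment_compl (hf : ∀ k, s ≤ k → k < t → G.Adj (f k) (f (k + 1)))
    (hclosed : f s = f t) (hr : t - s ≤ r) (hsi : s ≤ i) (hij : i ≤ j) (hjt : j ≤ t) {X : Set V}
    (hX : ∀ k, s ≤ k → k ≤ t → k ≤ i ∨ j ≤ k → f k ∉ X) {m : ℕ} (him : i ≤ m) (hmj : m ≤ j) :
    InSameComponent ((localBall G r (f m)).deleteVerts X) (f j) (f i) := by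
  have hseg : ∀ a b, s ≤ a → a ≤ b → b ≤ t → ∃ q : G.Walk (f a) (f b), q.length = b - a ∧
      ∀ x ∈ q.support, ∃ k, a ≤ k ∧ k ≤ b ∧ f k = x := by
    intro a b h₁ h₂ h₃
    exact exists_walk_of_seq f h₂ (G := G) fun k h₄ h₅ => hf k (by omega) (by omega)
  obtain ⟨q₁, h₁, h₁'⟩ := hseg j t (by omega) hjt le_rfl
  obtain ⟨q₂, h₂, h₂'⟩ := hseg s i le_rfl hsi (by omega)
  obtain ⟨q₃, h₃, -⟩ := hseg i m hsi him (by omega)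
  obtain ⟨q₄, h₄, -⟩ := hseg m j (by omega) hmj hjt
  refine inSameComponent_of_closed_walk ((q₁.copy rfl hclosed.symm).append q₂) (q₃.append q₄)
    (by simp) ?_ ?_
  · simp only [Walk.length_append, Walk.length_copy]
    omega
  · intro x hx
    rw [Walk.mem_support_append_iff, Walk.support_copy] at hx
    rcases hx with hx | hx
    · obtain ⟨k, h₅, h₆, rfl⟩ := h₁' x hx
      exact hX k (by omega) (by omega) (Or.inr h₅)
    · obtain ⟨k, h₅, h₆, rfl⟩ := h₂' x hx
      exact hX k (by omega) (by omega) (Or.inl h₆)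

end LocalComponents

/-! ### Alternating words in g and h, and shortest closed ones -/

section AlternatingWalks

variable {Γ : Type*} [Group Γ]

/-- Step number `i` of an alternating walk: multiplication by `h` or `h⁻¹` if `i` is even, by `g` if
`i ≡ 1 mod 4`, and by `g⁻¹` if `i ≡ 3 mod 4`. -/
def AltStep (g h : Γ) (i : ℕ) (x y : Γ) : Prop :=
  (i % 2 = 0 → y = x * h ∨ y = x * h⁻¹) ∧ (i % 4 = 1 → y = x * g) ∧ (i % 4 = 3 → y = x * g⁻¹)

/-- `f` is an alternating walk between the indices `s` and `t`. -/
def IsAltWalk (g h : Γ) (s t : ℕ) (f : ℕ → Γ) : Prop :=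
  ∀ i, s ≤ i → i < t → AltStep g h i (f i) (f (i + 1))

/-- There is a nontrivial closed alternating walk between the indices `s` and `t`. -/
def HasClosedAltWalk (g h : Γ) (s t : ℕ) : Prop :=
  s < t ∧ ∃ f, IsAltWalk g h s t f ∧ f s = f t

/-- Some alternating walk between the indices `s` and `t` spells the element `u`. -/
def AltReach (g h : Γ) (s t : ℕ) (u : Γ) : Prop :=
  s ≤ t ∧ ∃ f, IsAltWalk g h s t f ∧ f s = 1 ∧ f t = u

variable {g h : Γ} {s t : ℕ}

theorem altStep_even {i : ℕ} (hi : i % 2 = 0) {x y : Γ} (hxy : y = x * h ∨ y = x * h⁻¹) :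
    AltStep g h i x y :=
  ⟨fun _ => hxy, fun _ => by omega, fun _ => by omega⟩

theorem AltStep.mul_left {i : ℕ} {x y : Γ} (c : Γ) (hxy : AltStep g h i x y) :
    AltStep g h i (c * x) (c * y) := by
  obtain ⟨h₁, h₂, h₃⟩ := hxy
  refine ⟨fun hi => ?_, fun hi => ?_, fun hi => ?_⟩
  · rcases h₁ hi with rfl | rfl <;> simp [mul_assoc]
  · rw [h₂ hi, mul_assoc]
  · rw [h₃ hi, mul_assoc]

theorem AltReach.trans {t' : ℕ} {u v : Γ} (h₁ : AltReach g h s t u) (h₂ : AltReach g h t t' v) :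
    AltReach g h s t' (u * v) := by
  obtain ⟨hst, f₁, hf₁, hs₁, ht₁⟩ := h₁
  obtain ⟨htt, f₂, hf₂, hs₂, ht₂⟩ := h₂
  refine ⟨hst.trans htt, fun i => if i ≤ t then f₁ i else u * f₂ i, fun i hi hi' => ?_, ?_, ?_⟩
  · rcases lt_trichotomy i t with hit | rfl | hit
    · simpa [hit.le, Nat.succ_le_of_lt hit] using hf₁ i hi hit
    · have := (hf₂ i le_rfl hi').mul_left u
      simpa [ht₁, hs₂] using this
    · have := (hf₂ i hit.le hi').mul_left u
      simpa [hit, show ¬ i + 1 ≤ t by omega, show ¬ i ≤ t by omega] using this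
  · simp [hst, hs₁]
  · rcases htt.eq_or_lt with rfl | hlt
    · simp [ht₁, ← ht₂, hs₂]
    · simp [show ¬ t' ≤ t by omega, ht₂]

theorem altReach_one {u : Γ} (hu : AltStep g h s 1 u) : AltReach g h s (s + 1) u := by
  refine ⟨by omega, fun i => if i ≤ s then 1 else u, fun i h₁ h₂ => ?_, by simp, by simp⟩
  obtain rfl : i = s := by omega
  simpa using hu

theorem altReach_conj {a : Γ} (hs : s % 4 = 1) (ha : a = h ∨ a = h⁻¹) :
    AltReach g h s (s + 3) (g * a * g⁻¹) := by
  refine ((altReach_one (u := g) ?_).trans (altReach_one (u := a) ?_)).trans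
    (altReach_one (u := g⁻¹) ?_)
  · exact ⟨by omega, by simp, by omega⟩
  · exact altStep_even (by omega) (by simpa using ha)
  · exact ⟨by omega, by omega, by simp⟩

/-- With a = g h g⁻¹, c_m = [a, h]_m and w_m = a⁻¹ c_m, the recursion becomes w_{m+1} = w_m⁻¹ a⁻¹
w_m: the inner a⁻¹ a cancels. Each length ℓ thus becomes 2ℓ + 3, so ℓ + 3 doubles. The inverse w_m⁻¹
a w_m has the same shape, so both are carried through the induction. -/
theorem altReach_iterCommutator (m : ℕ) : ∀ s t : ℕ, s % 4 = 0 → t + 3 = s + 2 ^ (m + 3) →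
    AltReach g h s t ((g * h * g⁻¹)⁻¹ * iterCommutator (g * h * g⁻¹) h (m + 1)) ∧
      AltReach g h s t ((g * h * g⁻¹)⁻¹ * iterCommutator (g * h * g⁻¹) h (m + 1))⁻¹ := by
  have ha : ∀ s, s % 4 = 1 → AltReach g h s (s + 3) (g * h * g⁻¹) ∧
      AltReach g h s (s + 3) (g * h * g⁻¹)⁻¹ := fun s hs =>
    ⟨altReach_conj hs (Or.inl rfl), by
      simpa [mul_assoc] using altReach_conj (g := g) (h := h) (a := h⁻¹) hs (Or.inr rfl)⟩
  induction m with
  | zero =>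
    intro s t hs ht
    -- The base words are h⁻¹ a^{∓1} h, of length 1 + 3 + 1.
    obtain rfl : t = s + 1 + 3 + 1 := by omega
    have h₁ : AltReach g h s (s + 1) h := altReach_one (altStep_even (by omega) (by simp))
    have h₁' : AltReach g h s (s + 1) h⁻¹ := altReach_one (altStep_even (by omega) (by simp))
    have h₂ : AltReach g h (s + 1 + 3) (s + 1 + 3 + 1) h :=
      altReach_one (altStep_even (by omega) (by simp))
    obtain ⟨h₃, h₃'⟩ := ha (s + 1) (by omega)
    constructor
    · convert (h₁'.trans h₃').trans h₂ using 1
      simp only [iterCommutator]; group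
    · convert (h₁'.trans h₃).trans h₂ using 1
      simp only [iterCommutator]; group
  | succ m ih =>
    intro s t hs ht
    have hpow : 2 ^ (m + 1 + 3) = 2 * 2 ^ (m + 3) := by ring
    have h8 : 2 ^ (m + 3) = 8 * 2 ^ m := by ring
    have hm : 1 ≤ 2 ^ m := Nat.one_le_two_pow
    obtain ⟨t₁, ht₁⟩ : ∃ t₁, t₁ + 3 = s + 2 ^ (m + 3) := ⟨s + 2 ^ (m + 3) - 3, by omega⟩
    obtain ⟨-, h₁⟩ := ih s t₁ hs ht₁
    -- A word w_m has length 1 mod 4, so `t₁ % 4 = 1`: the conjugate of h fits next, and `t₁ + 3` is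
    -- again 0 mod 4.
    obtain ⟨h₂, h₂'⟩ := ha t₁ (by omega)
    obtain ⟨h₃, -⟩ := ih (t₁ + 3) t (by omega) (by omega)
    constructor
    · convert (h₁.trans h₂').trans h₃ using 1
      rw [iterCommutator.eq_2 _ _ (m + 1)]
      generalize iterCommutator (g * h * g⁻¹) h (m + 1) = w
      group
    · convert (h₁.trans h₂).trans h₃ using 1
      rw [iterCommutator.eq_2 _ _ (m + 1)]
      generalize iterCommutator (g * h * g⁻¹) h (m + 1) = w
      group

/-- Prefixing a, of length 3, to w_n, of length 2^{n+2} - 3, spells [a, h]_n. This length is where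
the bound on r comes from. The start index is 1 because the word begins with g. -/
theorem hasClosedAltWalk_of_iterCommutator_eq_one {n : ℕ} (hn : 1 ≤ n)
    (hc : iterCommutator (g * h * g⁻¹) h n = 1) : HasClosedAltWalk g h 1 (1 + 2 ^ (n + 2)) := by
  obtain ⟨m, rfl⟩ : ∃ m, n = m + 1 := ⟨n - 1, by omega⟩
  have h₁ : AltReach g h 1 4 (g * h * g⁻¹) := altReach_conj rfl (Or.inl rfl)
  have h₂ := (altReach_iterCommutator (g := g) (h := h) m 4 (1 + 2 ^ (m + 1 + 2)) rfl
    (by ring)).1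
  obtain ⟨-, f, hf, hs, ht⟩ := h₁.trans h₂
  exact ⟨by simp, f, hf, by rw [hs, ht, mul_inv_cancel_left, hc]⟩

theorem IsAltWalk.mono {f : ℕ → Γ} (hf : IsAltWalk g h s t f) {i j : ℕ} (hi : s ≤ i)
    (hj : j ≤ t) : IsAltWalk g h i j f :=
  fun k h₁ h₂ => hf k (hi.trans h₁) (h₂.trans_le hj)

/-- A closed alternating walk is minimal if no nontrivial closed alternating walk is shorter. -/
structure IsMinAltWalk (g h : Γ) (s t : ℕ) (f : ℕ → Γ) : Prop where
  lt : s < t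
  isAltWalk : IsAltWalk g h s t f
  closed : f s = f t
  le_of_closed : ∀ s' t', HasClosedAltWalk g h s' t' → t - s ≤ t' - s'

/-- The minimum is taken over all start indices, so the type of the first step is not controlled,
and the steps need not alternate across the base point. -/
theorem HasClosedAltWalk.exists_isMinAltWalk (hst : HasClosedAltWalk g h s t) :
    ∃ s' t' f, t' - s' ≤ t - s ∧ IsMinAltWalk g h s' t' f := by
  classical
  have hex : ∃ l s t, HasClosedAltWalk g h s t ∧ t - s = l := ⟨_, s, t, hst, rfl⟩
  obtain ⟨s', t', ⟨hlt, f, hf, hc⟩, hl⟩ := Nat.find_spec hex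
  have hmin : ∀ a b, HasClosedAltWalk g h a b → t' - s' ≤ b - a := fun a b hab => by
    rw [hl]; exact Nat.find_min' hex ⟨a, b, hab, rfl⟩
  exact ⟨s', t', f, hmin s t hst, hlt, hf, hc, hmin⟩

namespace IsMinAltWalk

variable {f : ℕ → Γ} {i j : ℕ}

/-- A repeated vertex cuts out a closed alternating subwalk, which by minimality must be everything.
-/
theorem eq_of_eq (hf : IsMinAltWalk g h s t f) (hsi : s ≤ i) (hij : i < j) (hjt : j ≤ t)
    (he : f i = f j) : i = s ∧ j = t := by
  have := hf.le_of_closed i j ⟨hij, f, hf.isAltWalk.mono hsi hjt, he⟩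
  omega

theorem ne_of_interior (hf : IsMinAltWalk g h s t f) (hsi : s < i) (hit : i < t) (hsj : s ≤ j)
    (hjt : j ≤ t) (hij : j ≠ i) : f j ≠ f i := by
  intro he
  rcases lt_or_gt_of_ne hij with hlt | hlt
  · have := hf.eq_of_eq hsj hlt hit.le he
    omega
  · have := hf.eq_of_eq hsi.le hlt hjt he.symm
    omega

/-- Since `i - 1` is even, an h-step from `f j` to `f i` can be prepended to the segment from `i` to
`j`. The result is a closed alternating walk of length `j - i + 1`; the index `i - 1` may lie below
`s`. -/
theorem le_of_chord_left (hf : IsMinAltWalk g h s t f) (hsi : s ≤ i) (hij : i ≤ j) (hjt : j ≤ t)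
    (hi : i % 2 = 1) (he : f i = f j * h ∨ f i = f j * h⁻¹) : t - s ≤ j - i + 1 := by
  have hw : HasClosedAltWalk g h (i - 1) j := by
    refine ⟨by omega, Function.update f (i - 1) (f j), fun k h₁ h₂ => ?_, ?_⟩
    · rw [Function.update_of_ne (show k + 1 ≠ i - 1 by omega)]
      rcases h₁.eq_or_lt with rfl | h₁
      · rw [Function.update_self, show i - 1 + 1 = i by omega]
        exact altStep_even (by omega) he
      · rw [Function.update_of_ne (by omega)]
        exact hf.isAltWalk k (by omega) (by omega)
    · rw [Function.update_self, Function.update_of_ne (by omega)]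
  have := hf.le_of_closed _ _ hw
  omega

/-- The mirror image: since `j` is even, the h-step closing the segment is appended at its end. -/
theorem le_of_chord_right (hf : IsMinAltWalk g h s t f) (hsi : s ≤ i) (hij : i ≤ j) (hjt : j ≤ t)
    (hj : j % 2 = 0) (he : f i = f j * h ∨ f i = f j * h⁻¹) : t - s ≤ j - i + 1 := by
  have hw : HasClosedAltWalk g h i (j + 1) := by
    refine ⟨by omega, Function.update f (j + 1) (f i), fun k h₁ h₂ => ?_, ?_⟩
    · rw [Function.update_of_ne (show k ≠ j + 1 by omega)]
      rcases (Nat.lt_succ_iff.1 h₂).eq_or_lt with rfl | h₂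
      · rw [Function.update_self]
        exact altStep_even (by omega) he
      · rw [Function.update_of_ne (by omega)]
        exact hf.isAltWalk k (by omega) (by omega)
    · rw [Function.update_self, Function.update_of_ne (by omega)]
  have := hf.le_of_closed _ _ hw
  omega

end IsMinAltWalk

theorem IsAltWalk.adj {S : Set Γ} (hS_one : (1 : Γ) ∉ S) (hg : g ∈ S) (hh : h ∈ S) {f : ℕ → Γ}
    (hf : IsAltWalk g h s t f) (k : ℕ) (hs : s ≤ k) (ht : k < t) :
    (mulCayley S).Adj (f k) (f (k + 1)) := by
  have hg1 : g ≠ 1 := fun h => hS_one (h ▸ hg)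
  have hh1 : h ≠ 1 := fun h' => hS_one (h' ▸ hh)
  obtain ⟨h₁, h₂, h₃⟩ := hf k hs ht
  rw [mulCayley_adj']
  obtain hk | hk | hk : k % 2 = 0 ∨ k % 4 = 1 ∨ k % 4 = 3 := by omega
  · rcases h₁ hk with h' | h' <;> rw [h']
    · exact ⟨by simpa using hh1, h, hh, by simp⟩
    · exact ⟨by simpa using hh1, h, hh, by simp⟩
  · rw [h₂ hk]; exact ⟨by simpa using hg1, g, hg, by simp⟩
  · rw [h₃ hk]; exact ⟨by simpa using hg1, g, hg, by simp⟩

/-! ### Connections that a shortest closed walk provides around separators -/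

namespace IsMinAltWalk

variable {S : Set Γ} {r : ℕ} {f : ℕ → Γ} {i : ℕ}

/-- At a vertex `y` of a minimal closed alternating walk with neighbours `y k⁻¹` and `y g` on it, the
separator `{y, y k}` does not separate `y k⁻¹` from `y g`, or does not separate it from `y k²`. -/
theorem inSameComponent_of_out (hf : IsMinAltWalk g h s t f) (hS_one : (1 : Γ) ∉ S) (hg : g ∈ S)
    (hh : h ∈ S) (hr : t - s ≤ r) {k : Γ} (hk : k = h ∨ k = h⁻¹) (hk₂ : k * k ≠ 1) (hgk : g ≠ k)
    (hsi : s < i) (hit : i < t) (hi : i % 4 = 1) (hprev : f (i - 1) = f i * k⁻¹) :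
    InSameComponent ((localBall (mulCayley S) r (f i)).deleteVerts {f i, f i * k})
        (f i * g) (f i * k⁻¹) ∨
      InSameComponent ((localBall (mulCayley S) r (f i)).deleteVerts {f i, f i * k})
        (f i * (k * k)) (f i * k⁻¹) := by
  have hadj := hf.isAltWalk.adj hS_one hg hh
  have hnext : f (i + 1) = f i * g := (hf.isAltWalk i hsi.le hit).2.1 hi
  have hkinv : k⁻¹ ≠ k := fun h' => hk₂ (by nth_rw 1 [← h']; simp)
  by_cases hex : ∃ j, s ≤ j ∧ j < t ∧ f j = f i * k
  · obtain ⟨j, hsj, hjt, hj⟩ := hex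
    have hji : j ≠ i := by
      rintro rfl
      apply hk₂
      simp [show k = 1 by simpa using hj]
    have hji₁ : j ≠ i - 1 := by
      rintro rfl
      rw [hprev] at hj
      exact hkinv (mul_left_cancel hj)
    rcases lt_or_gt_of_ne hji with hlt | hlt
    · obtain hj₂ | hj₂ : j % 2 = 1 ∨ j % 2 = 0 := by omega
      -- The chord forces `j = s` and `t = i + 1`, so y k = `f s` = `f t` = y g, against `hgk`.
      · have := hf.le_of_chord_left hsj hlt.le hit.le hj₂
          (by rw [hj]; rcases hk with rfl | rfl <;> simp)
        obtain ⟨rfl, rfl⟩ : j = s ∧ t = i + 1 := by omega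
        rw [hf.closed, hnext] at hj
        exact (hgk (mul_left_cancel hj)).elim
      -- The walk leaves y k by an h-step, which cannot return to the interior vertex y and so goes
      -- to y k².
      · have hj₃ : f (j + 1) = f i * (k * k) := by
          have hne := hf.ne_of_interior hsi hit (j := j + 1) (by omega) (by omega) (by omega)
          rcases (hf.isAltWalk j hsj hjt).1 hj₂ with h' | h' <;> rcases hk with rfl | rfl <;>
            rw [hj] at h' <;> simp_all [mul_assoc]
        have hseg := inSameComponent_of_segment hadj hf.closed hr (i := j + 1) (j := i - 1) (m := i)
          (X := {f i, f i * k}) (by omega) (by omega) (by omega) ?_ hsi.le hit.le (by omega)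
        · rw [hj₃, hprev] at hseg
          exact Or.inr hseg
        · rintro a h₁ h₂ (h' | h')
          · exact hf.ne_of_interior hsi hit (by omega) (by omega) (by omega) h'
          · have := hf.eq_of_eq hsj (show j < a by omega) (by omega) (hj.trans h'.symm)
            omega
    -- Here the chord closes a segment that is too short, because `s < i` and `j < t`.
    · have := hf.le_of_chord_left hsi.le hlt.le hjt.le (by omega)
          (by rw [hj]; rcases hk with rfl | rfl <;> simp)
      omega
  · push Not at hex
    have hseg := inSameComponent_of_segment_compl hadj hf.closed hr (i := i - 1) (j := i + 1)
      (m := i) (X := {f i, f i * k}) (by omega) (by omega) (by omega) ?_ (by omega) (by omega)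
    · rw [hnext, hprev] at hseg
      exact Or.inl hseg
    · rintro a h₁ h₂ h₃ (h' | h')
      · exact hf.ne_of_interior hsi hit h₁ h₂ (by omega) h'
      · rcases h₂.lt_or_eq with h₂ | rfl
        · exact hex a h₁ h₂ h'
        · exact hex s le_rfl hf.lt (hf.closed.trans h')

/-- The analogue of `inSameComponent_of_out` for a walk that enters `y` from `y g`. -/
theorem inSameComponent_of_in (hf : IsMinAltWalk g h s t f) (hS_one : (1 : Γ) ∉ S) (hg : g ∈ S)
    (hh : h ∈ S) (hr : t - s ≤ r) {k : Γ} (hk : k = h ∨ k = h⁻¹) (hk₂ : k * k ≠ 1)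
    (hsi : s < i) (hit : i < t) (hi : i % 4 = 0) (hnext : f (i + 1) = f i * k⁻¹) :
    InSameComponent ((localBall (mulCayley S) r (f i)).deleteVerts {f i, f i * k})
        (f i * g) (f i * k⁻¹) ∨
      InSameComponent ((localBall (mulCayley S) r (f i)).deleteVerts {f i, f i * k})
        (f i * (k * k)) (f i * k⁻¹) := by
  have hadj := hf.isAltWalk.adj hS_one hg hh
  have hprev : f (i - 1) = f i * g := by
    have := (hf.isAltWalk (i - 1) (by omega) (by omega)).2.2 (by omega)
    rw [show i - 1 + 1 = i by omega] at this
    simp [this]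
  have hkinv : k⁻¹ ≠ k := fun h' => hk₂ (by nth_rw 1 [← h']; simp)
  by_cases hex : ∃ j, s ≤ j ∧ j < t ∧ f j = f i * k
  · obtain ⟨j, hsj, hjt, hj⟩ := hex
    have hji : j ≠ i := by
      rintro rfl
      apply hk₂
      simp [show k = 1 by simpa using hj]
    have hji₁ : j ≠ i + 1 := by
      rintro rfl
      rw [hnext] at hj
      exact hkinv (mul_left_cancel hj)
    rcases lt_or_gt_of_ne hji with hlt | hlt
    -- Now `i` is even, so chords close on the right; this one would give y k = `f s` = `f t` = y
    -- k⁻¹.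
    · have := hf.le_of_chord_right hsj hlt.le hit.le (by omega)
          (by rw [hj]; rcases hk with rfl | rfl <;> simp)
      obtain ⟨rfl, rfl⟩ : j = s ∧ t = i + 1 := by omega
      rw [hf.closed, hnext] at hj
      exact (hkinv (mul_left_cancel hj)).elim
    · obtain hj₂ | hj₂ : j % 2 = 1 ∨ j % 2 = 0 := by omega
      -- The walk enters y k by an h-step, and not from y, hence from y k².
      · have hj₃ : f (j - 1) = f i * (k * k) := by
          have hne := hf.ne_of_interior hsi hit (j := j - 1) (by omega) (by omega) (by omega)
          have hst := (hf.isAltWalk (j - 1) (by omega) (by omega)).1 (by omega)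
          rw [show j - 1 + 1 = j by omega, hj] at hst
          rcases hst with h' | h' <;> rcases hk with rfl | rfl
          · exact (hne (mul_right_cancel h').symm).elim
          · rw [← mul_assoc, h', mul_inv_cancel_right]
          · rw [← mul_assoc, h', inv_mul_cancel_right]
          · exact (hne (mul_right_cancel h').symm).elim
        have hseg := inSameComponent_of_segment hadj hf.closed hr (i := i + 1) (j := j - 1) (m := i)
          (X := {f i, f i * k}) (by omega) (by omega) (by omega) ?_ hsi.le hit.le (by omega)
        · rw [hj₃, hnext] at hseg
          exact Or.inr hseg.symm
        · rintro a h₁ h₂ (h' | h')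
          · exact hf.ne_of_interior hsi hit (by omega) (by omega) (by omega) h'
          · have := hf.eq_of_eq (by omega) (show a < j by omega) (by omega) (h'.trans hj.symm)
            omega
      · have := hf.le_of_chord_right hsi.le hlt.le hjt.le hj₂
          (by rw [hj]; rcases hk with rfl | rfl <;> simp)
        omega
  · push Not at hex
    have hseg := inSameComponent_of_segment_compl hadj hf.closed hr (i := i - 1) (j := i + 1)
      (m := i) (X := {f i, f i * k}) (by omega) (by omega) (by omega) ?_ (by omega) (by omega)
    · rw [hnext, hprev] at hseg
      exact Or.inl hseg.symm
    · rintro a h₁ h₂ h₃ (h' | h')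
      · exact hf.ne_of_interior hsi hit h₁ h₂ (by omega) h'
      · rcases h₂.lt_or_eq with h₂ | rfl
        · exact hex a h₁ h₂ h'
        · exact hex s le_rfl hf.lt (hf.closed.trans h')

/-- Both ends of the middle edge of g⁻¹ h^{±1} g are interior, so the rest of the walk misses them
and joins their g-neighbours. -/
theorem inSameComponent_of_edge (hf : IsMinAltWalk g h s t f) (hS_one : (1 : Γ) ∉ S) (hg : g ∈ S)
    (hh : h ∈ S) (hr : t - s ≤ r) {p : ℕ} (hsp : s ≤ p) (hpt : p + 3 ≤ t) (hp : p % 4 = 3) :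
    InSameComponent ((localBall (mulCayley S) r (f (p + 1))).deleteVerts {f (p + 1), f (p + 2)})
      (f (p + 2) * g) (f (p + 1) * g) := by
  have hfst : f p = f (p + 1) * g := by
    rw [(hf.isAltWalk p (by omega) (by omega)).2.2 hp, inv_mul_cancel_right]
  have hlst : f (p + 3) = f (p + 2) * g :=
    (hf.isAltWalk (p + 2) (by omega) (by omega)).2.1 (by omega)
  rw [← hfst, ← hlst]
  refine inSameComponent_of_segment_compl (hf.isAltWalk.adj hS_one hg hh) hf.closed hr hsp
    (by omega) hpt ?_ (by omega) (by omega)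
  rintro a h₁ h₂ h₃ (h' | h')
  · exact hf.ne_of_interior (by omega) (by omega) h₁ h₂ (by omega) h'
  · exact hf.ne_of_interior (by omega) (by omega) h₁ h₂ (by omega) h'

end IsMinAltWalk

end AlternatingWalks

/-! ### Closed alternating walks of at most five steps -/

section ShortRelations

variable {Γ : Type*} [Group Γ] {g h : Γ}

theorem IsAltWalk.exists_zpow {s t : ℕ} {f : ℕ → Γ} (hf : IsAltWalk g h s t f) {i : ℕ}
    (hsi : s ≤ i) (hit : i < t) (hi : i % 2 = 0) :
    ∃ a : ℤ, (a = 1 ∨ a = -1) ∧ f (i + 1) = f i * h ^ a := by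
  rcases (hf i hsi hit).1 hi with h' | h'
  · exact ⟨1, Or.inl rfl, by simpa using h'⟩
  · exact ⟨-1, Or.inr rfl, by simpa using h'⟩

/-- A closed alternating walk either contains the pattern `g⁻¹ h^{±1} g`, or it is so short that
`g` conjugates `h^{±1}` to a small power of `h`. -/
theorem IsAltWalk.exists_pattern_or_conj {s t : ℕ} {f : ℕ → Γ} (hf : IsAltWalk g h s t f)
    (hst : s < t) (hc : f s = f t) (hh : h ≠ 1)
    (hg : ∀ c : ℤ, -2 ≤ c → c ≤ 2 → g ≠ h ^ c) :
    (∃ p, s ≤ p ∧ p + 3 ≤ t ∧ p % 4 = 3) ∨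
      ∃ b c : ℤ, (b = 1 ∨ b = -1) ∧ -2 ≤ c ∧ c ≤ 2 ∧ g * h ^ b * g⁻¹ = h ^ c := by
  have hpow : ∀ a : ℤ, (a = 1 ∨ a = -1) → h ^ a ≠ 1 := by
    rintro a (rfl | rfl) <;> simpa using hh
  have hg1 : g ≠ 1 := by simpa using hg 0 (by omega) (by omega)
  by_cases hp : ∃ p, s ≤ p ∧ p + 3 ≤ t ∧ p % 4 = 3
  · exact Or.inl hp
  refine Or.inr ?_
  have hp' : ∀ p, s ≤ p → p + 3 ≤ t → p % 4 ≠ 3 := fun p h₁ h₂ h₃ => hp ⟨p, h₁, h₂, h₃⟩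
  -- Among any four consecutive indices one is 3 mod 4, so six steps would contain the pattern.
  have hlen : t = s + 1 ∨ t = s + 2 ∨ t = s + 3 ∨ t = s + 4 ∨ t = s + 5 := by
    have h₀ := hp' s
    have h₁ := hp' (s + 1)
    have h₂ := hp' (s + 2)
    have h₃ := hp' (s + 3)
    omega
  have hE := fun i => hf.exists_zpow (i := i)
  have hG : ∀ i, s ≤ i → i < t → i % 4 = 1 → f (i + 1) = f i * g :=
    fun i h₁ h₂ h₃ => (hf i h₁ h₂).2.1 h₃
  have hG' : ∀ i, s ≤ i → i < t → i % 4 = 3 → f (i + 1) = f i * g⁻¹ :=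
    fun i h₁ h₂ h₃ => (hf i h₁ h₂).2.2 h₃
  have key : ∀ u : Γ, f t = f s * u → u = 1 := fun u hu => by simpa [hc] using hu
  obtain hs | hs | hs | hs : s % 4 = 0 ∨ s % 4 = 1 ∨ s % 4 = 2 ∨ s % 4 = 3 := by omega
  -- A relation with one letter g^{±1} makes g a power h^c with |c| ≤ 2, which is excluded. With two
  -- such letters, the at most two outer h-letters give the exponent c.
  · obtain ⟨a, ha, ea⟩ := hE s le_rfl hst (by omega)
    rcases hlen with rfl | rfl | rfl | rfl | rfl
    · exact (hpow a ha (key _ ea)).elim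
    · have e := key (h ^ a * g) (by rw [hG (s + 1) (by omega) (by omega) (by omega), ea, mul_assoc])
      exact (hg (-a) (by omega) (by omega) (by rw [zpow_neg]; exact eq_inv_of_mul_eq_one_right e)).elim
    · obtain ⟨b, hb, eb⟩ := hE (s + 2) (by omega) (by omega) (by omega)
      have e := key (h ^ a * g * h ^ b)
        (by rw [eb, hG (s + 1) (by omega) (by omega) (by omega), ea]; simp only [mul_assoc])
      refine (hg (-a - b) (by omega) (by omega) ?_).elim
      calc g = h ^ (-a) * (h ^ a * g * h ^ b) * h ^ (-b) := by group
        _ = h ^ (-a - b) := by rw [e]; group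
    · obtain ⟨b, hb, eb⟩ := hE (s + 2) (by omega) (by omega) (by omega)
      have e := key (h ^ a * g * h ^ b * g⁻¹)
        (by rw [hG' (s + 3) (by omega) (by omega) (by omega), eb,
              hG (s + 1) (by omega) (by omega) (by omega), ea]; simp only [mul_assoc])
      refine ⟨b, -a, hb, by omega, by omega, ?_⟩
      calc g * h ^ b * g⁻¹ = h ^ (-a) * (h ^ a * g * h ^ b * g⁻¹) := by group
        _ = h ^ (-a) := by rw [e, mul_one]
    · obtain ⟨b, hb, eb⟩ := hE (s + 2) (by omega) (by omega) (by omega)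
      obtain ⟨c, hc', ec⟩ := hE (s + 4) (by omega) (by omega) (by omega)
      have e := key (h ^ a * g * h ^ b * g⁻¹ * h ^ c)
        (by rw [ec, hG' (s + 3) (by omega) (by omega) (by omega), eb,
              hG (s + 1) (by omega) (by omega) (by omega), ea]; simp only [mul_assoc])
      refine ⟨b, -a - c, hb, by omega, by omega, ?_⟩
      calc g * h ^ b * g⁻¹ = h ^ (-a) * (h ^ a * g * h ^ b * g⁻¹ * h ^ c) * h ^ (-c) := by group
        _ = h ^ (-a - c) := by rw [e]; group
  · have e₁ := hG s le_rfl hst hs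
    rcases hlen with rfl | rfl | rfl | rfl | rfl
    · exact (hg1 (key _ e₁)).elim
    · obtain ⟨a, ha, ea⟩ := hE (s + 1) (by omega) (by omega) (by omega)
      have e := key (g * h ^ a) (by rw [ea, e₁, mul_assoc])
      exact (hg (-a) (by omega) (by omega) (by rw [zpow_neg]; exact eq_inv_of_mul_eq_one_left e)).elim
    · obtain ⟨a, ha, ea⟩ := hE (s + 1) (by omega) (by omega) (by omega)
      have e := key (g * h ^ a * g⁻¹)
        (by rw [hG' (s + 2) (by omega) (by omega) (by omega), ea, e₁]; simp only [mul_assoc])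
      exact (hpow a ha (conj_eq_one_iff.1 e)).elim
    · obtain ⟨a, ha, ea⟩ := hE (s + 1) (by omega) (by omega) (by omega)
      obtain ⟨b, hb, eb⟩ := hE (s + 3) (by omega) (by omega) (by omega)
      have e := key (g * h ^ a * g⁻¹ * h ^ b)
        (by rw [eb, hG' (s + 2) (by omega) (by omega) (by omega), ea, e₁]; simp only [mul_assoc])
      exact ⟨a, -b, ha, by omega, by omega, by rw [zpow_neg]; exact eq_inv_of_mul_eq_one_left e⟩
    · exact (hp' (s + 2) (by omega) (by omega) (by omega)).elim
  · obtain ⟨a, ha, ea⟩ := hE s le_rfl hst (by omega)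
    rcases hlen with rfl | rfl | rfl | rfl | rfl
    · exact (hpow a ha (key _ ea)).elim
    · have e := key (h ^ a * g⁻¹)
        (by rw [hG' (s + 1) (by omega) (by omega) (by omega), ea, mul_assoc])
      exact (hg a (by omega) (by omega) (mul_inv_eq_one.1 e).symm).elim
    · obtain ⟨b, hb, eb⟩ := hE (s + 2) (by omega) (by omega) (by omega)
      have e := key (h ^ a * g⁻¹ * h ^ b)
        (by rw [eb, hG' (s + 1) (by omega) (by omega) (by omega), ea]; simp only [mul_assoc])
      refine (hg (b + a) (by omega) (by omega) ?_).elim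
      calc g = h ^ b * (h ^ a * g⁻¹ * h ^ b)⁻¹ * h ^ a := by group
        _ = h ^ (b + a) := by rw [e]; group
    · exact (hp' (s + 1) (by omega) (by omega) (by omega)).elim
    · exact (hp' (s + 1) (by omega) (by omega) (by omega)).elim
  · have e₁ := hG' s le_rfl hst hs
    rcases hlen with rfl | rfl | rfl | rfl | rfl
    · exact (hg1 (inv_eq_one.1 (key _ e₁))).elim
    · obtain ⟨a, ha, ea⟩ := hE (s + 1) (by omega) (by omega) (by omega)
      have e := key (g⁻¹ * h ^ a) (by rw [ea, e₁, mul_assoc])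
      exact (hg a (by omega) (by omega) (inv_mul_eq_one.1 e)).elim
    · exact (hp' s (by omega) (by omega) (by omega)).elim
    · exact (hp' s (by omega) (by omega) (by omega)).elim
    · exact (hp' s (by omega) (by omega) (by omega)).elim

/-- If `g` conjugates `h^{±1}` to a small power of `h`, then `h g` or `h² g` is `g h` or `g h⁻¹`. -/
theorem exists_mul_eq_of_conj {b c : ℤ} (hh : h ≠ 1) (hb : b = 1 ∨ b = -1) (hc : -2 ≤ c)
    (hc' : c ≤ 2) (he : g * h ^ b * g⁻¹ = h ^ c) :
    ∃ k, (k = h ∨ k = h⁻¹) ∧ (h * g = g * k ∨ h * h * g = g * k) := by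
  have hk : h ^ b = h ∨ h ^ b = h⁻¹ := by rcases hb with rfl | rfl <;> simp
  have hk' : (h ^ b)⁻¹ = h ∨ (h ^ b)⁻¹ = h⁻¹ := by rcases hb with rfl | rfl <;> simp
  have e₁ : g * h ^ b = h ^ c * g := mul_inv_eq_iff_eq_mul.1 he
  have e₂ : g * (h ^ b)⁻¹ = h ^ (-c) * g := by
    rw [zpow_neg, ← he]; group
  obtain rfl | rfl | rfl | rfl | rfl : c = -2 ∨ c = -1 ∨ c = 0 ∨ c = 1 ∨ c = 2 := by omega
  · exact ⟨_, hk', Or.inr (by rw [e₂, neg_neg, zpow_ofNat, pow_two])⟩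
  · exact ⟨_, hk', Or.inl (by rw [e₂, neg_neg, zpow_one])⟩
  · rw [zpow_zero, conj_eq_one_iff] at he
    rcases hk with h' | h' <;> rw [h'] at he
    · exact (hh he).elim
    · exact (hh (inv_eq_one.1 he)).elim
  · exact ⟨_, hk, Or.inl (by rw [e₁, zpow_one])⟩
  · exact ⟨_, hk, Or.inr (by rw [e₁, zpow_ofNat, pow_two])⟩

end ShortRelations

/-! ### Links between the neighbours of 1 and h in the Cayley graph -/

section CayleyGraph

variable {Γ : Type*} [Group Γ] {S : Set Γ} {r : ℕ} {g h : Γ}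

theorem mulCayley_adj_mul (hS_one : (1 : Γ) ∉ S) (x : Γ) {s : Γ} (hs : s ∈ S) :
    (mulCayley S).Adj x (x * s) := by
  rw [mulCayley_adj']
  exact ⟨fun h => hS_one (by rwa [← left_eq_mul.1 h]), s, hs, Or.inl rfl⟩

theorem exists_mul_eq_of_mulCayley_adj (hS_inv : ∀ s ∈ S, s⁻¹ ∈ S) {x y : Γ}
    (hxy : (mulCayley S).Adj x y) : ∃ s ∈ S, y = x * s := by
  rw [mulCayley_adj'] at hxy
  obtain ⟨-, s, hs, h | h⟩ := hxy
  · exact ⟨s, hs, h.symm⟩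
  · exact ⟨s⁻¹, hS_inv s hs, eq_mul_inv_of_mul_eq h.symm⟩

/-- Left multiplication as an automorphism of a Cayley graph. -/
def mulCayleyLeft (S : Set Γ) (c : Γ) : mulCayley S ≃g mulCayley S where
  toEquiv := Equiv.mulLeft c
  map_rel_iff' := mulCayley_adj_mul_iff_right

/-- Moves what is found at a vertex y of a walk to the separator {1, h}: with k = h take c = 1, with
k = h⁻¹ take c = h. -/
theorem InSameComponent.translate {y k a b : Γ}
    (hab : InSameComponent ((localBall (mulCayley S) r y).deleteVerts {y, y * k}) (y * a) (y * b))
    (c : Γ) :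
    InSameComponent ((localBall (mulCayley S) r c).deleteVerts {c, c * k}) (c * a) (c * b) := by
  have hφ : ∀ x, mulCayleyLeft S (c * y⁻¹) (y * x) = c * x := fun x => by
    change c * y⁻¹ * (y * x) = c * x
    group
  have hφ₁ : mulCayleyLeft S (c * y⁻¹) y = c := by simpa using hφ 1
  have := hab.map (mulCayleyLeft S (c * y⁻¹))
  rwa [Set.image_pair, hφ, hφ, hφ, hφ₁] at this

theorem mem_setNeighborhood_of_mem (hS_one : (1 : Γ) ∉ S) {a : Γ} (ha : a ∈ S) (hah : a ≠ h) :
    a ∈ setNeighborhood (mulCayley S) {1, h} := by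
  refine ⟨?_, 1, Or.inl rfl, by simpa using mulCayley_adj_mul hS_one 1 ha⟩
  rintro (h' | h')
  · exact hS_one (h' ▸ ha)
  · exact hah h'

theorem mul_mem_setNeighborhood_of_mem (hS_one : (1 : Γ) ∉ S) {a : Γ} (ha : a ∈ S)
    (hah : a ≠ h⁻¹) : h * a ∈ setNeighborhood (mulCayley S) {1, h} := by
  refine ⟨?_, h, Or.inr rfl, mulCayley_adj_mul hS_one h ha⟩
  rintro (h' | h')
  · exact hah (eq_inv_of_mul_eq_one_right h')
  · rw [Set.mem_singleton_iff, mul_eq_left] at h'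
    exact hS_one (h' ▸ ha)

/-- The assumptions on the edge `{1, h}` and on a further generator `g`. -/
structure GoodPair (S : Set Γ) (g h : Γ) : Prop where
  one_notMem : (1 : Γ) ∉ S
  inv_mem : ∀ s ∈ S, s⁻¹ ∈ S
  left_mem : g ∈ S
  right_mem : h ∈ S
  sq_ne_one : h * h ≠ 1
  ne : g ≠ h
  ne_inv : g ≠ h⁻¹
  ne_sq : g ≠ h * h
  ne_inv_sq : g ≠ h⁻¹ * h⁻¹

namespace GoodPair

variable (H : GoodPair S g h)
include H

theorem right_ne_one : h ≠ 1 := fun h' => H.one_notMem (h' ▸ H.right_mem)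

theorem left_ne_one : g ≠ 1 := fun h' => H.one_notMem (h' ▸ H.left_mem)

theorem right_ne_inv : h ≠ h⁻¹ := fun h' => H.sq_ne_one (mul_eq_one_iff_eq_inv.2 h')

theorem left_ne_zpow (c : ℤ) (hc : -2 ≤ c) (hc' : c ≤ 2) : g ≠ h ^ c := by
  obtain rfl | rfl | rfl | rfl | rfl : c = -2 ∨ c = -1 ∨ c = 0 ∨ c = 1 ∨ c = 2 := by omega
  · rw [show (-2 : ℤ) = -1 + -1 by norm_num, zpow_add, zpow_neg_one]
    exact H.ne_inv_sq
  · simpa using H.ne_inv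
  · simpa using H.left_ne_one
  · simpa using H.ne
  · rw [zpow_ofNat, pow_two]
    exact H.ne_sq

theorem linked {a b : Γ} (ha : a = g ∨ a = h * g ∨ a = h⁻¹ ∨ a = h * h)
    (hb : b = g ∨ b = h * g ∨ b = h⁻¹ ∨ b = h * h)
    (hab : InSameComponent ((localBall (mulCayley S) r 1).deleteVerts {1, h}) a b ∨
      InSameComponent ((localBall (mulCayley S) r h).deleteVerts {1, h}) a b) :
    Linked (mulCayley S) r 1 h a b := by
  have key : ∀ a, a = g ∨ a = h * g ∨ a = h⁻¹ ∨ a = h * h →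
      a ∈ setNeighborhood (mulCayley S) {1, h} := by
    rintro a (rfl | rfl | rfl | rfl)
    · exact mem_setNeighborhood_of_mem H.one_notMem H.left_mem H.ne
    · exact mul_mem_setNeighborhood_of_mem H.one_notMem H.left_mem H.ne_inv
    · exact mem_setNeighborhood_of_mem H.one_notMem (H.inv_mem _ H.right_mem) H.right_ne_inv.symm
    · exact mul_mem_setNeighborhood_of_mem H.one_notMem H.right_mem H.right_ne_inv
  exact Linked.of_inSameComponent (key a ha) (key b hb) hab

/-- In the punctured ball around h, follow a walk from hg to h². If it avoids 1, it links hg to h².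
Otherwise it reaches 1 before h², and translation by h⁻¹ turns this connection into one from g to
h⁻¹ avoiding {1, h}. -/
theorem linked_or_linked (hr : 2 ≤ r) (hcut : ¬ IsLocalCutvertex (mulCayley S) r h) :
    Linked (mulCayley S) r 1 h g h⁻¹ ∨ Linked (mulCayley S) r 1 h (h * g) (h * h) := by
  have hadj := fun {s : Γ} (hs : s ∈ S) => mulCayley_adj_mul H.one_notMem h hs
  have hadj₁ : (mulCayley S).Adj h 1 := by simpa using hadj (H.inv_mem _ H.right_mem)
  rcases inSameComponent_or_of_not_isLocalCutvertex hcut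
    (mem_localBall_verts_of_adj hr (hadj H.left_mem)) (mem_localBall_verts_of_adj hr hadj₁)
    (mem_localBall_verts_of_adj hr (hadj H.right_mem)) (by simpa using H.left_ne_one)
    H.right_ne_one.symm (by simpa using H.right_ne_one) H.sq_ne_one.symm with h' | h'
  · exact Or.inr (H.linked (by simp) (by simp) (Or.inr h'))
  · have h'' : InSameComponent ((localBall (mulCayley S) r h).deleteVerts {h, h * h})
        (h * g) (h * h⁻¹) := by simpa using h'
    exact Or.inl (H.linked (by simp) (by simp) (Or.inl (by simpa using h''.translate 1)))

/-- The relation gives edges from x to hx for x = h⁻¹g, g, hg, hence a ladder of three squares; in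
each, the path avoiding 1 and h gives one link. -/
theorem linked_of_mul_eq (hr : 8 ≤ r) {k : Γ} (hk : k = h ∨ k = h⁻¹) (he : h * g = g * k) :
    Linked (mulCayley S) r 1 h g h⁻¹ ∧ Linked (mulCayley S) r 1 h (h * g) (h * h) ∧
      Linked (mulCayley S) r 1 h g (h * g) := by
  have hkS : k ∈ S := by
    rcases hk with rfl | rfl
    exacts [H.right_mem, H.inv_mem _ H.right_mem]
  have hadj := fun (x : Γ) {s : Γ} (hs : s ∈ S) => mulCayley_adj_mul H.one_notMem x hs
  have hg1 := H.left_ne_one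
  have hh1 := H.right_ne_one
  have a₁ : (mulCayley S).Adj 1 g := by simpa using hadj 1 H.left_mem
  have a₂ : (mulCayley S).Adj 1 h := by simpa using hadj 1 H.right_mem
  have a₃ : (mulCayley S).Adj 1 h⁻¹ := by simpa using hadj 1 (H.inv_mem _ H.right_mem)
  have a₄ : (mulCayley S).Adj g (h * g) := by rw [he]; exact hadj g hkS
  have a₅ : (mulCayley S).Adj (h⁻¹ * g) g := by
    simpa [mul_assoc, ← he] using hadj (h⁻¹ * g) hkS
  have a₆ : (mulCayley S).Adj (h * g) (h * h * g) := by
    simpa [mul_assoc, ← he] using hadj (h * g) hkS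
  have a₇ := hadj h H.left_mem
  have a₈ := hadj h H.right_mem
  have a₉ := hadj h⁻¹ H.left_mem
  have a₁₀ := hadj (h * h) H.left_mem
  have n₁ : h⁻¹ * g ≠ 1 := fun h' => H.ne (inv_mul_eq_one.1 h').symm
  have n₂ : h⁻¹ * g ≠ h := fun h' => H.ne_sq (inv_mul_eq_iff_eq_mul.1 h')
  have n₃ : h * g ≠ 1 := fun h' => H.ne_inv (eq_inv_of_mul_eq_one_right h')
  have n₄ : h * h * g ≠ 1 := fun h' => H.ne_inv_sq
    (by rw [← mul_inv_rev]; exact eq_inv_of_mul_eq_one_right h')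
  have n₅ : h * h * g ≠ h := fun h' => n₃ (by simpa [mul_assoc] using h')
  refine ⟨H.linked (by simp) (by simp) (Or.inl ?_), H.linked (by simp) (by simp) (Or.inr ?_),
    H.linked (by simp) (by simp) (Or.inl ?_)⟩
  · refine inSameComponent_of_closed_walk (Walk.cons a₅.symm (Walk.cons a₉.symm Walk.nil))
      (Walk.cons a₃.symm (Walk.cons a₁ Walk.nil)) (by simp) (by simp; omega) ?_
    simp [hg1, hh1, H.ne, n₁, n₂, H.right_ne_inv.symm]
  · refine inSameComponent_of_closed_walk (Walk.cons a₆ (Walk.cons a₁₀.symm Walk.nil))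
      (Walk.cons a₈.symm (Walk.cons a₇ Walk.nil)) (by simp) (by simp; omega) ?_
    simp [hg1, hh1, n₃, n₄, n₅, H.sq_ne_one]
  · refine inSameComponent_of_closed_walk (Walk.cons a₄ Walk.nil)
      (Walk.cons a₇.symm (Walk.cons a₂.symm (Walk.cons a₁ Walk.nil))) (by simp)
      (by simp; omega) ?_
    simp [hg1, H.ne, n₃]

/-- The edges from g to h²g and from h⁻¹g to hg close pentagons through 1 and h. They give two
separate links; joining them needs `linked_or_linked`. -/
theorem linked_of_sq_mul_eq (hr : 8 ≤ r) {k : Γ} (hk : k = h ∨ k = h⁻¹) (he : h * h * g = g * k) :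
    Linked (mulCayley S) r 1 h g (h * h) ∧ Linked (mulCayley S) r 1 h (h * g) h⁻¹ := by
  have hkS : k ∈ S := by
    rcases hk with rfl | rfl
    exacts [H.right_mem, H.inv_mem _ H.right_mem]
  have hadj := fun (x : Γ) {s : Γ} (hs : s ∈ S) => mulCayley_adj_mul H.one_notMem x hs
  have hg1 := H.left_ne_one
  have hh1 := H.right_ne_one
  have a₁ : (mulCayley S).Adj 1 g := by simpa using hadj 1 H.left_mem
  have a₂ : (mulCayley S).Adj 1 h := by simpa using hadj 1 H.right_mem
  have a₃ : (mulCayley S).Adj 1 h⁻¹ := by simpa using hadj 1 (H.inv_mem _ H.right_mem)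
  have a₄ : (mulCayley S).Adj g (h * h * g) := by rw [he]; exact hadj g hkS
  have a₅ : (mulCayley S).Adj (h⁻¹ * g) (h * g) := by
    simpa [mul_assoc, ← he] using hadj (h⁻¹ * g) hkS
  have a₇ := hadj h H.left_mem
  have a₈ := hadj h H.right_mem
  have a₉ := hadj h⁻¹ H.left_mem
  have a₁₀ := hadj (h * h) H.left_mem
  have n₁ : h⁻¹ * g ≠ 1 := fun h' => H.ne (inv_mul_eq_one.1 h').symm
  have n₂ : h⁻¹ * g ≠ h := fun h' => H.ne_sq (inv_mul_eq_iff_eq_mul.1 h')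
  have n₃ : h * g ≠ 1 := fun h' => H.ne_inv (eq_inv_of_mul_eq_one_right h')
  have n₄ : h * h * g ≠ 1 := fun h' => H.ne_inv_sq
    (by rw [← mul_inv_rev]; exact eq_inv_of_mul_eq_one_right h')
  have n₅ : h * h * g ≠ h := fun h' => n₃ (by simpa [mul_assoc] using h')
  refine ⟨H.linked (by simp) (by simp) (Or.inl ?_), H.linked (by simp) (by simp) (Or.inl ?_)⟩
  · refine inSameComponent_of_closed_walk (Walk.cons a₄ (Walk.cons a₁₀.symm Walk.nil))
      (Walk.cons a₈.symm (Walk.cons a₂.symm (Walk.cons a₁ Walk.nil))) (by simp)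
      (by simp; omega) ?_
    simp [hg1, hh1, H.ne, n₄, n₅, H.sq_ne_one]
  · refine inSameComponent_of_closed_walk (Walk.cons a₅.symm (Walk.cons a₉.symm Walk.nil))
      (Walk.cons a₃.symm (Walk.cons a₂ (Walk.cons a₇ Walk.nil))) (by simp)
      (by simp; omega) ?_
    simp [hg1, hh1, n₁, n₂, n₃, H.right_ne_inv.symm]

theorem linked_of_isMinAltWalk {s t p : ℕ} {f : ℕ → Γ} (hf : IsMinAltWalk g h s t f)
    (hr : t - s ≤ r) (hsp : s ≤ p) (hpt : p + 3 ≤ t) (hp : p % 4 = 3) :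
    Linked (mulCayley S) r 1 h g (h * g) ∧
      (Linked (mulCayley S) r 1 h g h⁻¹ ∨ Linked (mulCayley S) r 1 h h⁻¹ (h * h)) ∧
      (Linked (mulCayley S) r 1 h (h * g) (h * h) ∨ Linked (mulCayley S) r 1 h h⁻¹ (h * h)) := by
  have hstep := (hf.isAltWalk (p + 1) (by omega) (by omega)).1 (by omega)
  have hinv₂ : h⁻¹ * h⁻¹ ≠ 1 := by
    rw [← mul_inv_rev]; exact inv_ne_one.2 H.sq_ne_one
  have hout := fun (k : Γ) hk hk₂ hgk => hf.inSameComponent_of_out H.one_notMem H.left_mem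
    H.right_mem hr (k := k) (i := p + 2) hk hk₂ hgk (by omega) (by omega) (by omega)
  have hin := fun (k : Γ) hk hk₂ => hf.inSameComponent_of_in H.one_notMem H.left_mem
    H.right_mem hr (k := k) (i := p + 1) hk hk₂ (by omega) (by omega) (by omega)
  have hvert : ∀ k, k = h ∨ k = h⁻¹ → ∃ y,
      InSameComponent ((localBall (mulCayley S) r y).deleteVerts {y, y * k}) (y * g) (y * k⁻¹) ∨
      InSameComponent ((localBall (mulCayley S) r y).deleteVerts {y, y * k})
        (y * (k * k)) (y * k⁻¹) := by
    -- For each sign of k, exactly one end y of the middle edge has y k⁻¹ as its other end. It is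
    -- the later end, where the walk leaves by g, when the step is k, and the earlier end when the
    -- step is k⁻¹.
    rintro k (rfl | rfl) <;> rcases hstep with h' | h'
    · exact ⟨_, hout k (Or.inl rfl) H.sq_ne_one H.ne (by simp [h'])⟩
    · exact ⟨_, hin k (Or.inl rfl) H.sq_ne_one h'⟩
    · exact ⟨_, hin h⁻¹ (Or.inr rfl) hinv₂ (by simpa using h')⟩
    · exact ⟨_, hout h⁻¹ (Or.inr rfl) hinv₂ H.ne_inv (by simp [h'])⟩
  have hswap : ({1, h} : Set Γ) = {h, h * h⁻¹} := by rw [mul_inv_cancel, Set.pair_comm]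
  refine ⟨?_, ?_, ?_⟩
  · have hedge := hf.inSameComponent_of_edge H.one_notMem H.left_mem H.right_mem hr hsp hpt hp
    rcases hstep with h' | h' <;> rw [h', mul_assoc] at hedge
    · exact (H.linked (by simp) (by simp) (Or.inl (by simpa using hedge.translate 1))).symm
    · refine H.linked (by simp) (by simp) (Or.inr ?_)
      rw [hswap]
      simpa using hedge.translate h
  · obtain ⟨y, h' | h'⟩ := hvert h (Or.inl rfl)
    · exact Or.inl (H.linked (by simp) (by simp) (Or.inl (by simpa using h'.translate 1)))
    · exact Or.inr (H.linked (by simp) (by simp)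
        (Or.inl (by simpa using h'.translate 1))).symm
  · obtain ⟨y, h' | h'⟩ := hvert h⁻¹ (Or.inr rfl)
    · refine Or.inl (H.linked (by simp) (by simp) (Or.inr ?_))
      rw [hswap]
      simpa using h'.translate h
    · refine Or.inr (H.linked (by simp) (by simp) (Or.inr ?_))
      rw [hswap]
      simpa using h'.translate h

theorem all_linked {n : ℕ} (hn : 1 ≤ n) (hΓ : IteratedCommutatorsVanish Γ n)
    (hr : 2 ^ (n + 2) ≤ r) (hcut : ¬ IsLocalCutvertex (mulCayley S) r h) :
    Linked (mulCayley S) r 1 h g h⁻¹ ∧ Linked (mulCayley S) r 1 h (h * g) (h * h) ∧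
      Linked (mulCayley S) r 1 h h⁻¹ (h * h) := by
  have hr8 : 8 ≤ r := le_trans (Nat.pow_le_pow_right (n := 2) two_pos (show 3 ≤ n + 2 by omega)) hr
  have hN := H.linked_or_linked (by omega) hcut
  have hconj : ∀ b c : ℤ, (b = 1 ∨ b = -1) → -2 ≤ c → c ≤ 2 → g * h ^ b * g⁻¹ = h ^ c →
      Linked (mulCayley S) r 1 h g h⁻¹ ∧ Linked (mulCayley S) r 1 h (h * g) (h * h) ∧
        Linked (mulCayley S) r 1 h h⁻¹ (h * h) := by
    intro b c hb hc hc' he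
    obtain ⟨k, hk, he | he⟩ := exists_mul_eq_of_conj H.right_ne_one hb hc hc' he
    · obtain ⟨h₁, h₂, h₃⟩ := H.linked_of_mul_eq hr8 hk he
      exact ⟨h₁, h₂, h₁.symm.trans (h₃.trans h₂)⟩
    · obtain ⟨h₁, h₂⟩ := H.linked_of_sq_mul_eq hr8 hk he
      rcases hN with h₃ | h₃
      · have h₄ := h₃.symm.trans h₁
        exact ⟨h₃, h₂.trans h₄, h₄⟩
      · have h₄ := h₂.symm.trans h₃
        exact ⟨h₁.trans h₄.symm, h₃, h₄⟩
  by_cases heq : EquivElem (g * h * g⁻¹) h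
  · rcases heq with he | he
    · exact hconj 1 1 (Or.inl rfl) (by omega) (by omega) (by simpa using he)
    · exact hconj 1 (-1) (Or.inl rfl) (by omega) (by omega) (by simpa using he)
  · obtain ⟨s, t, f, hlen, hf⟩ :=
      (hasClosedAltWalk_of_iterCommutator_eq_one hn (hΓ _ _ heq)).exists_isMinAltWalk
    rcases hf.isAltWalk.exists_pattern_or_conj hf.lt hf.closed H.right_ne_one H.left_ne_zpow with
      ⟨p, hsp, hpt, hp⟩ | ⟨b, c, hb, hc, hc', he⟩
    · obtain ⟨h₁, h₂, h₃⟩ := H.linked_of_isMinAltWalk hf (r := r) (by omega) hsp hpt hp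
      have h₄ : Linked (mulCayley S) r 1 h h⁻¹ (h * h) := by
        rcases h₂ with h₂ | h₂
        · rcases h₃ with h₃ | h₃
          · exact h₂.symm.trans (h₁.trans h₃)
          · exact h₃
        · exact h₂
      rcases hN with h₅ | h₅
      · exact ⟨h₅, h₁.symm.trans (h₅.trans h₄), h₄⟩
      · exact ⟨h₁.trans (h₅.trans h₄.symm), h₅, h₄⟩
    · exact hconj b c hb hc hc' he

end GoodPair

end CayleyGraph

/-! ### Connecting all neighbours of the separator -/

theorem connectivityGraph_preconnected_of_goodPair {Γ : Type*} [Group Γ] {S : Set Γ} {g h : Γ}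
    (H : GoodPair S g h) {n r : ℕ} (hn : 1 ≤ n) (hΓ : IteratedCommutatorsVanish Γ n)
    (hr : 2 ^ (n + 2) ≤ r) (hcut : ¬ IsLocalCutvertex (mulCayley S) r h) :
    (connectivityGraph (mulCayley S) r 1 h).Preconnected := by
  have hr8 : 8 ≤ r := le_trans (Nat.pow_le_pow_right (n := 2) two_pos (show 3 ≤ n + 2 by omega)) hr
  have hlink := (H.all_linked hn hΓ hr hcut).2.2
  have hgood : ∀ s ∈ S, s ≠ h → s ≠ h⁻¹ → s ≠ h * h → s ≠ h⁻¹ * h⁻¹ → GoodPair S s h :=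
    fun s hs h₁ h₂ h₃ h₄ => ⟨H.one_notMem, H.inv_mem, hs, H.right_mem, H.sq_ne_one, h₁, h₂, h₃, h₄⟩
  have hadj := fun (x : Γ) => mulCayley_adj_mul H.one_notMem x H.right_mem
  have ha₁ : (mulCayley S).Adj h⁻¹ 1 := by simpa using hadj h⁻¹
  have ha₂ : (mulCayley S).Adj (h⁻¹ * h⁻¹) h⁻¹ := by simpa using hadj (h⁻¹ * h⁻¹)
  suffices key : ∀ d ∈ setNeighborhood (mulCayley S) {1, h},
      Linked (mulCayley S) r 1 h d h⁻¹ by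
    rintro ⟨a, ha⟩ ⟨b, hb⟩
    obtain ⟨_, _, hab⟩ := (key a ha).trans (key b hb).symm
    exact hab
  intro d hd
  have hd' := hd
  obtain ⟨hdX, x, hx | hx, hxd⟩ := hd'
  · obtain ⟨s, hs, rfl⟩ := exists_mul_eq_of_mulCayley_adj H.inv_mem hxd
    rw [Set.mem_singleton_iff.1 (show x ∈ ({1} : Set Γ) from hx)] at *
    rw [one_mul] at *
    by_cases h₁ : s = h
    · exact (hdX (Or.inr h₁)).elim
    by_cases h₂ : s = h⁻¹
    -- Going there and back gives the reflexive link.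
    · subst h₂; exact hlink.trans hlink.symm
    by_cases h₃ : s = h * h
    · subst h₃; exact hlink.symm
    by_cases h₄ : s = h⁻¹ * h⁻¹
    · subst h₄
      refine Linked.of_inSameComponent hd hlink.1 (Or.inl ?_)
      -- The triangle 1, h⁻¹, h⁻² contains an edge from h⁻² to h⁻¹.
      refine inSameComponent_of_closed_walk (Walk.cons ha₂ Walk.nil)
        (Walk.cons ha₁ (Walk.cons hxd Walk.nil)) (by simp) (by simp; omega) ?_
      intro y hy
      rw [Walk.support_cons, Walk.support_nil, List.mem_cons, List.mem_singleton] at hy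
      rcases hy with rfl | rfl
      · exact hdX
      · exact hlink.1.1
    · exact ((hgood s hs h₁ h₂ h₃ h₄).all_linked hn hΓ hr hcut).1
  · obtain ⟨s, hs, rfl⟩ := exists_mul_eq_of_mulCayley_adj H.inv_mem hxd
    rw [Set.mem_singleton_iff.1 hx] at *
    by_cases h₁ : s = h
    · subst h₁; exact hlink.symm
    by_cases h₂ : s = h⁻¹
    · exact (hdX (Or.inl (by simp [h₂]))).elim
    by_cases h₃ : s = h * h
    · subst h₃
      have ha₃ : (mulCayley S).Adj (h * (h * h)) (h * h) := by
        simpa [mul_assoc] using (hadj (h * h)).symm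
      refine Linked.trans (Linked.of_inSameComponent hd hlink.symm.1 (Or.inr ?_)) hlink.symm
      -- The triangle h, h², h³ contains an edge from h³ to h².
      refine inSameComponent_of_closed_walk (Walk.cons ha₃ Walk.nil)
        (Walk.cons (hadj h).symm (Walk.cons hxd Walk.nil)) (by simp) (by simp; omega) ?_
      intro y hy
      rw [Walk.support_cons, Walk.support_nil, List.mem_cons, List.mem_singleton] at hy
      rcases hy with rfl | rfl
      · exact hdX
      · exact hlink.symm.1.1
    by_cases h₄ : s = h⁻¹ * h⁻¹
    · subst h₄
      rw [mul_inv_cancel_left]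
      exact hlink.trans hlink.symm
    · have := (hgood s hs h₁ h₂ h₃ h₄).all_linked hn hΓ hr hcut
      exact this.2.1.trans hlink.symm

theorem mainTheorem4 {Γ : Type*} [Group Γ] (n : ℕ) (hn : 1 ≤ n)
    (hΓ : IteratedCommutatorsVanish Γ n)
    (S : Set Γ) (hS_one : (1 : Γ) ∉ S) (hS_inv : ∀ s ∈ S, s⁻¹ ∈ S)
    (hS_gen : Subgroup.closure S = ⊤)
    (r : ℕ) (hr : 2 ^ (n + 2) ≤ r)
    (h : Γ) (hS : h ∈ S)
    (hsep : IsLocalTwoSeparator (SimpleGraph.mulCayley S) r 1 h)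
    (hcut : ∀ v : Γ, ¬ IsLocalCutvertex (SimpleGraph.mulCayley S) r v)
    (hinv : orderOf h ≠ 2) :
    S ⊆ {h, h⁻¹, h ^ 2, (h ^ 2)⁻¹} ∧ IsCyclic Γ := by
  have hh1 : h ≠ 1 := fun h' => hS_one (h' ▸ hS)
  have hsub : S ⊆ {h, h⁻¹, h ^ 2, (h ^ 2)⁻¹} := by
    intro g hg
    by_contra hgn
    simp only [Set.mem_insert_iff, Set.mem_singleton_iff, not_or] at hgn
    obtain ⟨h₁, h₂, h₃, h₄⟩ := hgn
    refine hsep.2.2 (connectivityGraph_preconnected_of_goodPair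
      ⟨hS_one, hS_inv, hg, hS, fun h' => hinv ?_, h₁, h₂, ?_, ?_⟩ hn hΓ hr (hcut h))
    · exact orderOf_eq_prime (by rw [pow_two, h']) hh1
    · rwa [← pow_two]
    · rwa [← mul_inv_rev, ← pow_two]
  refine ⟨hsub, h, fun x => ?_⟩
  have hle : Subgroup.closure S ≤ Subgroup.zpowers h := by
    rw [Subgroup.closure_le]
    intro s hs
    have hh := Subgroup.mem_zpowers h
    rcases hsub hs with rfl | rfl | rfl | rfl
    exacts [hh, inv_mem hh, pow_mem hh 2, inv_mem (pow_mem hh 2)]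
  exact hle (hS_gen ▸ Subgroup.mem_top x)
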